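/- Let $n\in\mathbb N\cup\{\omega\}$ and let $\mathbf{Glob}_n$ be the category of $n$-globular sets (sets $X_i$ for natural numbers $i\le n$, with source and target maps $X_{i+1}\to X_i$ satisfying the globular identities). For $m\le n$, let $(-)_{\le m}\colon\mathbf{Glob}_n\to\mathbf{Glob}_m$ be the truncation functor, $(-)_{\uparrow n}\colon\mathbf{Glob}_m\to\mathbf{Glob}_n$ its left adjoint, which adds no globes above dimension $m$, and $i_X\colon (X_{\le m})_{\uparrow n}\to X$ the counit. Let $T$ be a finitary monad on $\mathbf{Glob}_n$ (its underlying functor preserves directed colimits). Put $T^n=T$ and, for $k<n$, let $T^k=(-)_{\le k}\circ T\circ(-)_{\uparrow n}$ be the induced monad on $\mathbf{Glob}_k$. Write $\mathbf{Alg}_k$ for the category of $T^k$-algebras, and $F_k\dashv U_k$ for the free/forgetful adjunction between $\mathbf{Glob}_k$ and $\mathbf{Alg}_k$, with unit $\eta^k$ and counit $\epsilon^k$. For $k<l$, the truncation functor $(-)_{\le k}\colon\mathbf{Alg}_l\to\mathbf{Alg}_k$ sends $(X,h)$ to $X_{\le k}$ with structure map $T^k(X_{\le k})\to (T^lX)_{\le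 k}\xrightarrow{h_{\le k}}X_{\le k}$, where the first map is induced by $i_X$. Let $k\in\mathbb N$ with $k+1\le n$. The category $\mathbf{Alg}_k^+$ of $k$-cellular extensions is the pullback of $U_k\colon\mathbf{Alg}_k\to\mathbf{Glob}_k$ and $(-)_{\le k}\colon\mathbf{Glob}_{k+1}\to\mathbf{Glob}_k$: its objects are the pairs $(C,X)$ with $C\in\mathbf{Alg}_k$, $X\in\mathbf{Glob}_{k+1}$ and $U_kC=X_{\le k}$. Let $V_k\colon\mathbf{Alg}_{k+1}\to\mathbf{Alg}_k^+$ be the functor $D\mapsto(D_{\le k},U_{k+1}D)$. **Theorem.** The functor $V_k$ has a left adjoint, and so has the truncation functor $(-)_{\le k}\colon\mathbf{Alg}_{k+1}\to\mathbf{Alg}_k$. Moreover, for every left adjoint $I\colon\mathbf{Alg}_k\to\mathbf{Alg}_{k+1}$ of $(-)_{\le k}$, with unit $\alpha$, and every left adjoint $(C,X)\mapsto C[X]$ of $V_k$, and for every $(C,X)\in\mathbf{Alg}_k^+$, the square $$\begin{array}{ccc} F_{k+1}\big((X_{\le k})_{\uparrow k+1}\big) & \xrightarrow{\;F_{k+1}(i_X)\;}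 & F_{k+1}X\\ {\scriptstyle I(\epsilon^k_C)\,\circ\,\theta_{X_{\le k}}}\big\downarrow & & \big\downarrow{\scriptstyle p^{\mathrm R}}\\ I(C) & \xrightarrow{\;\;p^{\mathrm L}\;\;} & C[X] \end{array}$$ is a pushout in $\mathbf{Alg}_{k+1}$. Here, for $Z\in\mathbf{Glob}_k$, $\theta_Z\colon F_{k+1}(Z_{\uparrow k+1})\to I(F_kZ)$ is the composite of $F_{k+1}\big((\eta^k_Z)_{\uparrow k+1}\big)$, $F_{k+1}\big((U_k\alpha_{F_kZ})_{\uparrow k+1}\big)$, $F_{k+1}\big(i_{U_{k+1}I F_kZ}\big)$ and $\epsilon^{k+1}_{I F_kZ}$; and $p^{\mathrm L}$ and $p^{\mathrm R}$ are the transposes, under $I\dashv(-)_{\le k}$ and $F_{k+1}\dashv U_{k+1}$, of the two components $C\to (C[X])_{\le k}$ and $X\to U_{k+1}(C[X])$ of the unit $(C,X)\to V_k(C[X])$. -/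

import Mathlib

open CategoryTheory CategoryTheory.Limits

universe u

/-! ### Globular sets -/

/-- An `n`-globular set, for `n ∈ ℕ ∪ {ω}` (`ω` is `⊤ : ℕ∞`): sets `X_i` of `i`-globes for the
natural numbers `i ≤ n`, with source and target maps `X_{i+1} → X_i` satisfying the globular
identities. -/
structure GlobSet (n : ℕ∞) : Type (u + 1) where
  cell (i : ℕ) (hi : (i : ℕ∞) ≤ n) : Type u
  src (i : ℕ) (hi : (i : ℕ∞) ≤ n) (hi' : ((i + 1 : ℕ) : ℕ∞) ≤ n) : cell (i + 1) hi' → cell i hi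
  tgt (i : ℕ) (hi : (i : ℕ∞) ≤ n) (hi' : ((i + 1 : ℕ) : ℕ∞) ≤ n) : cell (i + 1) hi' → cell i hi
  src_src (i : ℕ) (hi : (i : ℕ∞) ≤ n) (hi' : ((i + 1 : ℕ) : ℕ∞) ≤ n)
    (hi'' : ((i + 1 + 1 : ℕ) : ℕ∞) ≤ n) (x : cell (i + 1 + 1) hi'') :
    src i hi hi' (src (i + 1) hi' hi'' x) = src i hi hi' (tgt (i + 1) hi' hi'' x)
  tgt_src (i : ℕ) (hi : (i : ℕ∞) ≤ n) (hi' : ((i + 1 : ℕ) : ℕ∞) ≤ n)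
    (hi'' : ((i + 1 + 1 : ℕ) : ℕ∞) ≤ n) (x : cell (i + 1 + 1) hi'') :
    tgt i hi hi' (src (i + 1) hi' hi'' x) = tgt i hi hi' (tgt (i + 1) hi' hi'' x)

namespace GlobSet

/-- A morphism of `n`-globular sets. -/
@[ext]
structure Hom {n : ℕ∞} (X Y : GlobSet.{u} n) : Type u where
  map (i : ℕ) (hi : (i : ℕ∞) ≤ n) : X.cell i hi → Y.cell i hi
  map_src (i : ℕ) (hi : (i : ℕ∞) ≤ n) (hi' : ((i + 1 : ℕ) : ℕ∞) ≤ n) (x : X.cell (i + 1) hi') :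
    Y.src i hi hi' (map (i + 1) hi' x) = map i hi (X.src i hi hi' x)
  map_tgt (i : ℕ) (hi : (i : ℕ∞) ≤ n) (hi' : ((i + 1 : ℕ) : ℕ∞) ≤ n) (x : X.cell (i + 1) hi') :
    Y.tgt i hi hi' (map (i + 1) hi' x) = map i hi (X.tgt i hi hi' x)

/-- The category `Glob_n` of `n`-globular sets. -/
instance (n : ℕ∞) : Category.{u} (GlobSet.{u} n) where
  Hom X Y := Hom X Y
  id X := ⟨fun _ _ x => x, fun _ _ _ _ => rfl, fun _ _ _ _ => rfl⟩
  comp f g :=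
    ⟨fun i hi x => g.map i hi (f.map i hi x),
      fun i hi hi' x => by rw [g.map_src i hi hi', f.map_src i hi hi'],
      fun i hi hi' x => by rw [g.map_tgt i hi hi', f.map_tgt i hi hi']⟩

theorem hom_ext {n : ℕ∞} {X Y : GlobSet.{u} n} {f g : X ⟶ Y}
    (h : ∀ (i : ℕ) (hi : (i : ℕ∞) ≤ n) (x : X.cell i hi), f.map i hi x = g.map i hi x) : f = g :=
  Hom.ext (funext fun i => funext fun hi => funext fun x => h i hi x)

/-- The truncation functor `Glob_n ⥤ Glob_m` for `m ≤ n`, forgetting the globes of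
dimension `> m`. -/
def trunc {m n : ℕ∞} (h : m ≤ n) : GlobSet.{u} n ⥤ GlobSet.{u} m where
  obj X :=
    { cell := fun i hi => X.cell i (hi.trans h)
      src := fun i hi hi' => X.src i (hi.trans h) (hi'.trans h)
      tgt := fun i hi hi' => X.tgt i (hi.trans h) (hi'.trans h)
      src_src := fun i hi hi' hi'' =>
        X.src_src i (hi.trans h) (hi'.trans h) (hi''.trans h)
      tgt_src := fun i hi hi' hi'' =>
        X.tgt_src i (hi.trans h) (hi'.trans h) (hi''.trans h) }
  map f :=
    { map := fun i hi => f.map i (hi.trans h)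
      map_src := fun i hi hi' => f.map_src i (hi.trans h) (hi'.trans h)
      map_tgt := fun i hi hi' => f.map_tgt i (hi.trans h) (hi'.trans h) }

/-- The inclusion functor `Glob_m ⥤ Glob_n` for `m ≤ n`, adding no globes of dimension `> m`.
The set of `i`-globes is a sum over the proofs of `i ≤ m`: it is `X_i` when `i ≤ m`, and it is
empty otherwise. -/
def inc {m n : ℕ∞} (_h : m ≤ n) : GlobSet.{u} m ⥤ GlobSet.{u} n where
  obj X :=
    { cell := fun i _ => Σ' hi : (i : ℕ∞) ≤ m, X.cell i hi
      src := fun i _ _ x =>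
        ⟨le_trans (Nat.cast_le.2 (Nat.le_succ i)) x.1, X.src i _ x.1 x.2⟩
      tgt := fun i _ _ x =>
        ⟨le_trans (Nat.cast_le.2 (Nat.le_succ i)) x.1, X.tgt i _ x.1 x.2⟩
      src_src := fun i _ _ _ x => by rw [X.src_src i]
      tgt_src := fun i _ _ _ x => by rw [X.tgt_src i] }
  map f :=
    { map := fun i _ x => ⟨x.1, f.map i x.1 x.2⟩
      map_src := fun i _ _ x => PSigma.ext rfl (heq_of_eq (f.map_src i _ x.1 x.2))
      map_tgt := fun i _ _ x => PSigma.ext rfl (heq_of_eq (f.map_tgt i _ x.1 x.2)) }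

/-- The canonical map `X ⟶ trunc (inc X)`, an isomorphism: on `i`-globes, it is the identity
of `X_i`. -/
def incTruncUnit {m n : ℕ∞} (h : m ≤ n) : 𝟭 (GlobSet.{u} m) ⟶ inc h ⋙ trunc h where
  app X :=
    { map := fun _ hi x => ⟨hi, x⟩
      map_src := fun _ _ _ _ => rfl
      map_tgt := fun _ _ _ _ => rfl }

/-- The canonical map `i_X : inc (trunc X) ⟶ X`. -/
def incTruncCounit {m n : ℕ∞} (h : m ≤ n) : trunc h ⋙ inc h ⟶ 𝟭 (GlobSet.{u} n) where
  app X :=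
    { map := fun _ _ x => x.2
      map_src := fun _ _ _ _ => rfl
      map_tgt := fun _ _ _ _ => rfl }

/-- The adjunction between inclusion and truncation of globular sets. -/
def incTruncAdj {m n : ℕ∞} (h : m ≤ n) : inc.{u} h ⊣ trunc.{u} h where
  unit := incTruncUnit h
  counit := incTruncCounit h

/-- For `k ≤ l ≤ n`, the canonical map `inc^k_n (trunc^l_k X) ⟶ inc^l_n X`. Under the canonical
identification of `inc^k_n` with `inc^l_n ∘ inc^k_l`, this is the image under `inc^l_n` of
`i_X : inc^k_l (trunc^l_k X) ⟶ X`. -/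
def incTruncTo {k l n : ℕ∞} (hkl : k ≤ l) (hln : l ≤ n) :
    trunc.{u} hkl ⋙ inc.{u} (hkl.trans hln) ⟶ inc.{u} hln where
  app X :=
    { map := fun _ _ x => ⟨x.1.trans hkl, x.2⟩
      map_src := fun _ _ _ _ => rfl
      map_tgt := fun _ _ _ _ => rfl }

end GlobSet

/-! ### Monads and monad functors -/

/-- A monad is finitary when its underlying functor preserves (small) directed colimits, that is,
colimits indexed by nonempty directed partial orders. -/
class IsFinitaryMonad {C : Type (u + 1)} [Category.{u} C] (T : Monad C) : Prop where
  preservesDirectedColimits (J : Type u) [PartialOrder J] [IsDirectedOrder J] [Nonempty J] :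
    PreservesColimitsOfShape J T.toFunctor

/-- A monad functor `(F, α)` from a monad `S` on `C` to a monad `T` on `D`, with
`α : T F ⟶ F S`. -/
structure MndFunctor {C D : Type*} [Category* C] [Category* D] (S : Monad C) (T : Monad D) where
  functor : C ⥤ D
  trans : functor ⋙ T.toFunctor ⟶ S.toFunctor ⋙ functor
  unit (X : C) : T.η.app (functor.obj X) ≫ trans.app X = functor.map (S.η.app X)
  mul (X : C) : T.μ.app (functor.obj X) ≫ trans.app X =
    T.map (trans.app X) ≫ trans.app (S.obj X) ≫ functor.map (S.μ.app X)

/-- The functor between Eilenberg-Moore categories induced by a monad functor: it maps an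
algebra `(X, h)` to `(F X, F h ∘ α_X)`. -/
def MndFunctor.em {C D : Type*} [Category* C] [Category* D] {S : Monad C} {T : Monad D}
    (M : MndFunctor S T) : S.Algebra ⥤ T.Algebra where
  obj A :=
    { A := M.functor.obj A.A
      a := M.trans.app A.A ≫ M.functor.map A.a
      unit := by
        rw [← Category.assoc, M.unit, ← M.functor.map_comp, A.unit]
        exact M.functor.map_id _
      assoc := by
        have h := M.trans.naturality A.a
        dsimp at h
        rw [← Category.assoc, M.mul, T.map_comp, Category.assoc, Category.assoc, Category.assoc,
          ← M.functor.map_comp, A.assoc, M.functor.map_comp, reassoc_of% h] }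
  map f :=
    { f := M.functor.map f.f
      h := by
        have h := M.trans.naturality f.f
        dsimp at h
        dsimp
        rw [reassoc_of% h, Category.assoc, ← M.functor.map_comp, ← M.functor.map_comp, f.h] }

/-- The monad `R S L` on `D` obtained from an adjunction `L ⊣ R` with `R : C ⥤ D` and a monad `S`
on `C`. -/
def adjMonad {C D : Type*} [Category* C] [Category* D] {L : D ⥤ C} {R : C ⥤ D} (adj : L ⊣ R)
    (S : Monad C) : Monad D where
  toFunctor := L ⋙ S.toFunctor ⋙ R
  η :=
    { app := fun Y => adj.unit.app Y ≫ R.map (S.η.app (L.obj Y))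
      naturality := fun X Y f => by
        have h := S.η.naturality (L.map f)
        have h' := adj.unit.naturality f
        dsimp at h h' ⊢
        rw [reassoc_of% h', Category.assoc, ← R.map_comp, ← R.map_comp, h] }
  μ :=
    { app := fun Y => R.map (S.map (adj.counit.app (S.obj (L.obj Y))) ≫ S.μ.app (L.obj Y))
      naturality := fun X Y f => by
        have h := S.μ.naturality (L.map f)
        have h' := adj.counit.naturality (S.map (L.map f))
        dsimp at h h' ⊢
        rw [← R.map_comp, ← R.map_comp, ← S.map_comp_assoc, h', S.map_comp_assoc, h,
          Category.assoc] }
  left_unit := fun Y => by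
    have h := S.η.naturality (adj.counit.app (S.obj (L.obj Y)))
    dsimp at h ⊢
    rw [Category.assoc, ← R.map_comp, ← reassoc_of% h, S.left_unit]
    exact (congrArg (adj.unit.app _ ≫ R.map ·) (Category.comp_id _)).trans
      (adj.right_triangle_components _)
  right_unit := fun Y => by
    have h := adj.counit.naturality (S.η.app (L.obj Y))
    dsimp at h ⊢
    rw [← R.map_comp, ← S.map_comp_assoc, L.map_comp, Category.assoc, h,
      adj.left_triangle_components_assoc, S.right_unit]
    exact R.map_id _
  assoc := fun Y => by
    have h := adj.counit.naturality
      (S.map (adj.counit.app (S.obj (L.obj Y))) ≫ S.μ.app (L.obj Y))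
    have h' := S.μ.naturality (adj.counit.app (S.obj (L.obj Y)))
    dsimp at h h' ⊢
    rw [← R.map_comp, ← R.map_comp, ← S.map_comp_assoc, h]
    simp only [S.map_comp, Category.assoc, S.assoc]
    rw [reassoc_of% h']

/-- The functor `R` of an adjunction `L ⊣ R` underlies a monad functor from `S` to `R S L`, with
the natural transformation `R S ε : R S L R ⟶ R S`. -/
def adjMndFunctor {C D : Type*} [Category* C] [Category* D] {L : D ⥤ C} {R : C ⥤ D} (adj : L ⊣ R)
    (S : Monad C) : MndFunctor S (adjMonad adj S) where
  functor := R
  trans :=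
    { app := fun X => R.map (S.map (adj.counit.app X))
      naturality := fun X Y f => by
        have h := adj.counit.naturality f
        dsimp [adjMonad] at h ⊢
        rw [← R.map_comp, ← R.map_comp, ← S.map_comp, ← S.map_comp, h] }
  unit X := by
    have h := S.η.naturality (adj.counit.app X)
    dsimp [adjMonad] at h ⊢
    rw [Category.assoc, ← R.map_comp, ← h, R.map_comp, adj.right_triangle_components_assoc]
  mul X := by
    have h := S.μ.naturality (adj.counit.app X)
    have h' := adj.counit.naturality (S.map (adj.counit.app X))
    dsimp [adjMonad] at h h' ⊢
    rw [← R.map_comp, ← R.map_comp, ← R.map_comp, ← S.map_comp_assoc, h', Category.assoc, ← h,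
      S.map_comp_assoc]

/-! ### Globular algebras -/

namespace GlobSet

variable {n : ℕ∞} (T : Monad (GlobSet.{u} n))

/-- The monad `T^k = trunc_k T inc_n` on `Glob_k`, for `k < n`. -/
def truncMonad (k : ℕ) (hk : (k : ℕ∞) < n) : Monad (GlobSet.{u} k) :=
  adjMonad (incTruncAdj hk.le) T

/-- For `k < l < n`, the truncation functor `Glob_l ⥤ Glob_k` underlies a monad functor from
`T^l` to `T^k`, with the natural transformation `trunc_k T inc^k_n trunc^l_k ⟶ trunc_k T inc^l_n`
given by the canonical map `inc^k_n (trunc^l_k X) ⟶ inc^l_n X`. -/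
def truncMndFunctor {k l : ℕ} (hkl : (k : ℕ∞) < l) (hl : (l : ℕ∞) < n) :
    MndFunctor (truncMonad T l hl) (truncMonad T k (hkl.trans hl)) where
  functor := trunc hkl.le
  trans :=
    { app := fun X => (trunc (hkl.trans hl).le).map (T.map ((incTruncTo hkl.le hl.le).app X))
      naturality := fun X Y f => congrArg (fun g => (trunc (hkl.trans hl).le).map g) (by
        have h := (incTruncTo hkl.le hl.le).naturality f
        rw [← T.map_comp, ← T.map_comp]
        exact congrArg (fun g => T.map g) h :
          T.map ((inc (hkl.trans hl).le).map ((trunc hkl.le).map f)) ≫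
              T.map ((incTruncTo hkl.le hl.le).app Y) =
            T.map ((incTruncTo hkl.le hl.le).app X) ≫ T.map ((inc hl.le).map f)) }
  unit X := congrArg
    (fun g => (incTruncUnit (hkl.trans hl).le).app ((trunc hkl.le).obj X) ≫
      (trunc (hkl.trans hl).le).map g)
    (T.η.naturality ((incTruncTo hkl.le hl.le).app X)).symm
  mul X := congrArg (fun g => (trunc (hkl.trans hl).le).map g) (by
    have h := T.μ.naturality ((incTruncTo hkl.le hl.le).app X)
    have h' := (incTruncCounit (hkl.trans hl).le).naturality
      (T.map ((incTruncTo hkl.le hl.le).app X))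
    dsimp at h h'
    rw [Category.assoc, ← h, ← T.map_comp_assoc, ← h', T.map_comp_assoc]
    exact congrArg (fun g => T.map ((inc (hkl.trans hl).le).map ((trunc (hkl.trans hl).le).map
        (T.map ((incTruncTo hkl.le hl.le).app X)))) ≫ g ≫ T.μ.app ((inc hl.le).obj X))
      (T.map_comp ((incTruncTo hkl.le hl.le).app ((trunc hl.le).obj (T.obj ((inc hl.le).obj X))))
        ((incTruncCounit hl.le).app (T.obj ((inc hl.le).obj X)))) :
      (T.map ((incTruncCounit (hkl.trans hl).le).app
          (T.obj ((inc (hkl.trans hl).le).obj ((trunc hkl.le).obj X)))) ≫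
        T.μ.app ((inc (hkl.trans hl).le).obj ((trunc hkl.le).obj X))) ≫
          T.map ((incTruncTo hkl.le hl.le).app X) =
        T.map ((inc (hkl.trans hl).le).map ((trunc (hkl.trans hl).le).map
          (T.map ((incTruncTo hkl.le hl.le).app X)))) ≫
          T.map ((incTruncTo hkl.le hl.le).app ((trunc hl.le).obj (T.obj ((inc hl.le).obj X)))) ≫
            T.map ((incTruncCounit hl.le).app (T.obj ((inc hl.le).obj X))) ≫
              T.μ.app ((inc hl.le).obj X))

end GlobSet

/-- The dimensions `k` at which algebras of a monad on `n`-globular sets are considered: `n`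
itself, and the natural numbers `k < n`. -/
inductive Level (n : ℕ∞) : Type
  | top : Level n
  | below (k : ℕ) (hk : (k : ℕ∞) < n) : Level n

namespace Level

/-- The dimension `k ∈ ℕ ∪ {ω}` of a level. -/
def dim {n : ℕ∞} : Level n → ℕ∞
  | top => n
  | below k _ => k

theorem dim_le {n : ℕ∞} : (l : Level n) → l.dim ≤ n
  | top => le_rfl
  | below _ hk => hk.le

theorem dim_injective {n : ℕ∞} : Function.Injective (dim (n := n))
  | top, top, _ => rfl
  | top, below _ hk, h => absurd h hk.ne'
  | below _ hk, top, h => absurd h hk.ne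
  | below _ _, below _ _, h => by
    obtain rfl := Nat.cast_injective (R := ℕ∞) h
    rfl

theorem exists_dim_eq {n : ℕ∞} {k : ℕ} (hk : (k : ℕ∞) ≤ n) : ∃ l : Level n, l.dim = k :=
  hk.lt_or_eq.elim (fun h => ⟨below k h, rfl⟩) fun h => ⟨top, h.symm⟩

theorem lt_of_dim_eq {n : ℕ∞} {k : ℕ} {m l : Level n} (hm : m.dim = k) (hl : l.dim = (k + 1 : ℕ)) :
    m.dim < l.dim := by
  rw [hm, hl]
  exact Nat.cast_lt.2 (Nat.lt_succ_self k)

end Level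

section Algebras

variable {n : ℕ∞} (T : Monad (GlobSet.{u} n))

/-- The monad on globular sets of dimension `l`: `T` itself for `l = n`, and `T^k` for
`l = k < n`. -/
def levelMonad : (l : Level n) → Monad (GlobSet.{u} l.dim)
  | .top => T
  | .below k hk => GlobSet.truncMonad T k hk

/-- The category `Alg_l` of globular algebras of dimension `l`. -/
abbrev GlobAlg (l : Level n) := (levelMonad T l).Algebra

/-- The forgetful functor `U_l : Alg_l ⥤ Glob_l`. -/
abbrev globForget (l : Level n) : GlobAlg T l ⥤ GlobSet.{u} l.dim := (levelMonad T l).forget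

/-- The free algebra functor `F_l : Glob_l ⥤ Alg_l`. -/
abbrev globFree (l : Level n) : GlobSet.{u} l.dim ⥤ GlobAlg T l := (levelMonad T l).free

/-- The adjunction `F_l ⊣ U_l`. -/
abbrev globAdj (l : Level n) : globFree T l ⊣ globForget T l := (levelMonad T l).adj

/-- The natural transformation `T^m (trunc X) ⟶ trunc (T^l X)`, for levels `m < l`. -/
def levelTrans : {m l : Level n} → (h : m.dim < l.dim) →
    (GlobSet.trunc.{u} h.le ⋙ (levelMonad T m).toFunctor ⟶
      (levelMonad T l).toFunctor ⋙ GlobSet.trunc.{u} h.le)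
  | .top, l, h => absurd l.dim_le (not_le_of_gt h)
  | .below _ _, .top, h => (adjMndFunctor (GlobSet.incTruncAdj (le_of_lt h)) T).trans
  | .below _ _, .below _ hl, h => (GlobSet.truncMndFunctor T h hl).trans

/-- The truncation functor `Glob_l ⥤ Glob_m` as a monad functor, for levels `m < l`. -/
def levelMndFunctor {m l : Level n} (h : m.dim < l.dim) :
    MndFunctor (levelMonad T l) (levelMonad T m) where
  functor := GlobSet.trunc h.le
  trans := levelTrans T h
  unit := match m, l, h with
    | .top, l, h => absurd l.dim_le (not_le_of_gt h)
    | .below _ _, .top, h => (adjMndFunctor (GlobSet.incTruncAdj (le_of_lt h)) T).unit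
    | .below _ _, .below _ hl, h => (GlobSet.truncMndFunctor T h hl).unit
  mul := match m, l, h with
    | .top, l, h => absurd l.dim_le (not_le_of_gt h)
    | .below _ _, .top, h => (adjMndFunctor (GlobSet.incTruncAdj (le_of_lt h)) T).mul
    | .below _ _, .below _ hl, h => (GlobSet.truncMndFunctor T h hl).mul

/-- The truncation functor `Alg_l ⥤ Alg_m` for `m < l`, mapping an algebra `(X, h)` to `trunc X`
with the structure map `T^m (trunc X) ⟶ trunc (T^l X) ⟶ trunc X`. -/
def algTrunc {m l : Level n} (h : m.dim < l.dim) : GlobAlg T l ⥤ GlobAlg T m :=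
  (levelMndFunctor T h).em

end Algebras

/-! ### Cellular extensions -/

/-- The strict pullback of categories: objects are the pairs `(X, Y)` of objects of `A` and `B`
with `F X = G Y`. -/
structure StrictPullback {A B E : Type*} [Category* A] [Category* B] [Category* E]
    (F : A ⥤ E) (G : B ⥤ E) where
  left : A
  right : B
  eq : F.obj left = G.obj right

namespace StrictPullback

variable {A B E : Type*} [Category* A] [Category* B] [Category* E] {F : A ⥤ E} {G : B ⥤ E}

/-- A morphism `(X, Y) ⟶ (X', Y')` of the strict pullback is a pair of morphisms
`f : X ⟶ X'` and `g : Y ⟶ Y'` with `F f = G g`, modulo the identities `F X = G Y` and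
`F X' = G Y'`. -/
@[ext]
structure Hom (P Q : StrictPullback F G) where
  left : P.left ⟶ Q.left
  right : P.right ⟶ Q.right
  w : F.map left ≫ eqToHom Q.eq = eqToHom P.eq ≫ G.map right

instance : Category (StrictPullback F G) where
  Hom P Q := Hom P Q
  id P := ⟨𝟙 _, 𝟙 _, by simp⟩
  comp f g := ⟨f.left ≫ g.left, f.right ≫ g.right, by
    rw [F.map_comp, Category.assoc, g.w, reassoc_of% f.w, G.map_comp]⟩

variable (F G)

/-- The first projection of the strict pullback. -/
def fst : StrictPullback F G ⥤ A where
  obj P := P.left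
  map f := f.left

/-- The second projection of the strict pullback. -/
def snd : StrictPullback F G ⥤ B where
  obj P := P.right
  map f := f.right

end StrictPullback

/-! In what follows, `m` and `l` are two levels with `m < l`; the definitions are used for
`m = k` and `l = k + 1`. -/

section CellularExtensions

variable {n : ℕ∞} (T : Monad (GlobSet.{u} n)) {m l : Level n} (h : m.dim < l.dim)

/-- The category `Alg_k^+` of `k`-cellular extensions (for `m = k`, `l = k + 1`): the pullback of
`U_k : Alg_k ⥤ Glob_k` and the truncation functor `Glob_{k+1} ⥤ Glob_k`. -/
abbrev CellExt := StrictPullback (globForget T m) (GlobSet.trunc.{u} h.le)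

/-- The functor `Alg_{k+1} ⥤ Alg_k^+` (for `m = k`, `l = k + 1`) induced by the truncation functor
`Alg_{k+1} ⥤ Alg_k` and the forgetful functor `U_{k+1}`. -/
def algToCellExt : GlobAlg T l ⥤ CellExt T h where
  obj D := ⟨(algTrunc T h).obj D, (globForget T l).obj D, rfl⟩
  map f := ⟨(algTrunc T h).map f, (globForget T l).map f,
    (Category.comp_id _).trans (Category.id_comp _).symm⟩

variable {T} {h} {I : GlobAlg T m ⥤ GlobAlg T l}

/-- For `I ⊣ algTrunc`, the comparison map `θ_Z : F_{k+1} (inc Z) ⟶ I (F_k Z)`, which is the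
composite `F inc Z ⟶ F inc U F_k Z ⟶ F inc U trunc I F_k Z = F inc trunc U I F_k Z ⟶ F U I F_k Z
⟶ I F_k Z` of the maps induced by the two units, by `inc trunc ⟶ 𝟭`, and by the counit. -/
def theta (adjI : I ⊣ algTrunc T h) (Z : GlobSet.{u} m.dim) :
    (globFree T l).obj ((GlobSet.inc h.le).obj Z) ⟶ I.obj ((globFree T m).obj Z) :=
  (globFree T l).map ((GlobSet.inc h.le).map ((globAdj T m).unit.app Z)) ≫
    (globFree T l).map ((GlobSet.inc h.le).map
      ((globForget T m).map (adjI.unit.app ((globFree T m).obj Z)))) ≫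
    (globFree T l).map ((GlobSet.incTruncCounit h.le).app
      ((globForget T l).obj (I.obj ((globFree T m).obj Z)))) ≫
    (globAdj T l).counit.app (I.obj ((globFree T m).obj Z))

/-- The map `e^R : F_{k+1} (inc (trunc X)) ⟶ F_{k+1} X` of a cellular extension `(C, X)`. -/
def eRight (E : CellExt T h) :
    (globFree T l).obj ((GlobSet.inc h.le).obj ((GlobSet.trunc h.le).obj E.right)) ⟶
      (globFree T l).obj E.right :=
  (globFree T l).map ((GlobSet.incTruncCounit h.le).app E.right)

/-- The map `F_{k+1} (inc (trunc X)) = F_{k+1} (inc (U_k C)) ⟶ I (F_k (U_k C)) ⟶ I C` of a cellular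
extension `(C, X)`, composed of `θ` and of the image under `I` of the counit of `F_k ⊣ U_k`. -/
def eLeftTheta (adjI : I ⊣ algTrunc T h) (E : CellExt T h) :
    (globFree T l).obj ((GlobSet.inc h.le).obj ((GlobSet.trunc h.le).obj E.right)) ⟶
      I.obj E.left :=
  (globFree T l).map ((GlobSet.inc h.le).map (eqToHom E.eq.symm)) ≫
    theta adjI ((globForget T m).obj E.left) ≫ I.map ((globAdj T m).counit.app E.left)

variable {L : CellExt T h ⥤ GlobAlg T l}

/-- The map `p^L : I C ⟶ L (C, X)` corresponding, under the adjunction `I ⊣ algTrunc`, to the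
component `C ⟶ trunc (L (C, X))` of the unit of `L ⊣ algToCellExt`. -/
def pLeft (adjI : I ⊣ algTrunc T h) (adjL : L ⊣ algToCellExt T h) (E : CellExt T h) :
    I.obj E.left ⟶ L.obj E :=
  (adjI.homEquiv E.left (L.obj E)).symm (adjL.unit.app E).left

/-- The map `p^R : F_{k+1} X ⟶ L (C, X)` corresponding, under the adjunction `F_{k+1} ⊣ U_{k+1}`,
to the component `X ⟶ U_{k+1} (L (C, X))` of the unit of `L ⊣ algToCellExt`. -/
def pRight (adjL : L ⊣ algToCellExt T h) (E : CellExt T h) :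
    (globFree T l).obj E.right ⟶ L.obj E :=
  ((globAdj T l).homEquiv E.right (L.obj E)).symm (adjL.unit.app E).right

end CellularExtensions

/-! By transposition, a morphism `F_{k+1}((X_{≤k})↑) ⟶ D` is a map `X_{≤k} ⟶ (U_{k+1} D)_{≤k}`.
Under this bijection, restricting `F_{k+1} X ⟶ D` along `F_{k+1}(i_X)` is truncating its transpose.
Restricting `I C ⟶ D` along the left leg of the span is applying `U_k` to its transpose, because `θ`
is the comparison of two left adjoints of `U_k ∘ (-)_{≤k} = (-)_{≤k} ∘ U_{k+1}`. So a pair of maps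
out of `F_{k+1} X` and `I C` makes the square commute exactly when its transposes form a morphism
`(C, X) ⟶ V_k D` (`eRight_comp_eq_eLeftTheta_comp_iff`). Hence a pushout of the span has the
universal property of `C[X]`, and conversely.

What remains is existence. The functor `U_k ∘ (-)_{≤k}` is a right adjoint and `U_k` is monadic, so
adjoint lifting yields `I` once `Alg_{k+1}` has reflexive coequalizers; the left adjoint of `V_k`
needs pushouts. `hasColimits_algebra` provides both. It applies the general adjoint functor theorem
to the diagonal functors: the images of the legs of a cocone generate a subalgebra whose size
depends only on the diagram. Finitarity makes the generation stop after `ω` steps. -/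

namespace GlobSet

variable {N : ℕ∞}

@[simp]
theorem id_map (X : GlobSet.{u} N) (i : ℕ) (hi : (i : ℕ∞) ≤ N) (x : X.cell i hi) :
    Hom.map (𝟙 X) i hi x = x := rfl

@[simp]
theorem comp_map {X Y Z : GlobSet.{u} N} (f : X ⟶ Y) (g : Y ⟶ Z) (i : ℕ) (hi : (i : ℕ∞) ≤ N)
    (x : X.cell i hi) : Hom.map (f ≫ g) i hi x = g.map i hi (f.map i hi x) := rfl

theorem congr_map {X Y : GlobSet.{u} N} {f g : X ⟶ Y} (h : f = g) (i : ℕ) (hi : (i : ℕ∞) ≤ N)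
    (x : X.cell i hi) : f.map i hi x = g.map i hi x := by rw [h]

/-! ### Limits of globular sets -/

section Limits

variable {J : Type u} [Category.{u} J] (F : J ⥤ GlobSet.{u} N)

/-- The limit of a diagram of globular sets, whose cells are the compatible families of cells. -/
def limitCone : Cone F where
  pt :=
    { cell := fun i hi => {x : ∀ j, (F.obj j).cell i hi //
        ∀ (j j' : J) (f : j ⟶ j'), (F.map f).map i hi (x j) = x j'}
      src := fun i hi hi' x => ⟨fun j => (F.obj j).src i hi hi' (x.1 j), fun _ _ f => by
        rw [← (F.map f).map_src i hi hi', x.2 _ _ f]⟩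
      tgt := fun i hi hi' x => ⟨fun j => (F.obj j).tgt i hi hi' (x.1 j), fun _ _ f => by
        rw [← (F.map f).map_tgt i hi hi', x.2 _ _ f]⟩
      src_src := fun i hi hi' hi'' x => Subtype.ext (funext fun j => (F.obj j).src_src i _ _ _ _)
      tgt_src := fun i hi hi' hi'' x => Subtype.ext (funext fun j => (F.obj j).tgt_src i _ _ _ _) }
  π :=
    { app := fun j => ⟨fun _ _ x => x.1 j, fun _ _ _ _ => rfl, fun _ _ _ _ => rfl⟩
      naturality := fun _ _ f => hom_ext fun i hi x => (x.2 _ _ f).symm }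

/-- The cone of compatible families is a limit. -/
def limitConeIsLimit : IsLimit (limitCone F) where
  lift s :=
    { map := fun i hi x => ⟨fun j => (s.π.app j).map i hi x, fun _ _ f =>
        congr_map (s.w f) i hi x⟩
      map_src := fun i hi hi' x => Subtype.ext (funext fun j => (s.π.app j).map_src i hi hi' x)
      map_tgt := fun i hi hi' x => Subtype.ext (funext fun j => (s.π.app j).map_tgt i hi hi' x) }
  fac _ _ := rfl
  uniq _ _ hf := hom_ext fun i hi x => Subtype.ext (funext fun j => congr_map (hf j) i hi x)

instance : HasLimits (GlobSet.{u} N) where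
  has_limits_of_shape _ _ := ⟨fun F => ⟨⟨⟨limitCone F, limitConeIsLimit F⟩⟩⟩⟩

end Limits

/-! ### Globular subsets -/

/-- A globular subset: a family of sets of cells closed under sources and targets. -/
structure Sub (Y : GlobSet.{u} N) where
  carrier (i : ℕ) (hi : (i : ℕ∞) ≤ N) : Set (Y.cell i hi)
  src_mem (i : ℕ) (hi : (i : ℕ∞) ≤ N) (hi' : ((i + 1 : ℕ) : ℕ∞) ≤ N) (x : Y.cell (i + 1) hi') :
    x ∈ carrier (i + 1) hi' → Y.src i hi hi' x ∈ carrier i hi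
  tgt_mem (i : ℕ) (hi : (i : ℕ∞) ≤ N) (hi' : ((i + 1 : ℕ) : ℕ∞) ≤ N) (x : Y.cell (i + 1) hi') :
    x ∈ carrier (i + 1) hi' → Y.tgt i hi hi' x ∈ carrier i hi

/-- A morphism is injective on cells. -/
def CellInjective {X Y : GlobSet.{u} N} (f : X ⟶ Y) : Prop :=
  ∀ (i : ℕ) (hi : (i : ℕ∞) ≤ N), Function.Injective (f.map i hi)

theorem CellInjective.mono {X Y : GlobSet.{u} N} {f : X ⟶ Y} (h : CellInjective f) : Mono f where
  right_cancellation _ _ w := hom_ext fun i hi x => h i hi (congr_map w i hi x)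

namespace Sub

variable {X Y : GlobSet.{u} N}

instance : LE (Sub Y) where
  le A B := ∀ (i : ℕ) (hi : (i : ℕ∞) ≤ N), A.carrier i hi ⊆ B.carrier i hi

/-- The globular set of the cells in a globular subset. -/
def toGlobSet (A : Sub Y) : GlobSet.{u} N where
  cell i hi := A.carrier i hi
  src i hi hi' x := ⟨Y.src i hi hi' x.1, A.src_mem i hi hi' x.1 x.2⟩
  tgt i hi hi' x := ⟨Y.tgt i hi hi' x.1, A.tgt_mem i hi hi' x.1 x.2⟩
  src_src i _ _ _ x := Subtype.ext (Y.src_src i _ _ _ x.1)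
  tgt_src i _ _ _ x := Subtype.ext (Y.tgt_src i _ _ _ x.1)

/-- The inclusion of a globular subset. -/
def incl (A : Sub Y) : A.toGlobSet ⟶ Y where
  map _ _ x := x.1
  map_src _ _ _ _ := rfl
  map_tgt _ _ _ _ := rfl

theorem incl_injective (A : Sub Y) : CellInjective A.incl := fun _ _ => Subtype.val_injective

/-- The corestriction of a morphism to a globular subset. -/
def lift (A : Sub Y) (f : X ⟶ Y)
    (h : ∀ (i : ℕ) (hi : (i : ℕ∞) ≤ N) (x : X.cell i hi), f.map i hi x ∈ A.carrier i hi) :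
    X ⟶ A.toGlobSet where
  map i hi x := ⟨f.map i hi x, h i hi x⟩
  map_src i hi hi' x := Subtype.ext (f.map_src i hi hi' x)
  map_tgt i hi hi' x := Subtype.ext (f.map_tgt i hi hi' x)

/-- The inclusion between two globular subsets. -/
def inclusion {A B : Sub Y} (h : A ≤ B) : A.toGlobSet ⟶ B.toGlobSet :=
  B.lift A.incl fun i hi x => h i hi x.2

/-- The image of a morphism. -/
def range (f : X ⟶ Y) : Sub Y where
  carrier i hi := Set.range (f.map i hi)
  src_mem := by
    rintro i hi hi' _ ⟨x, rfl⟩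
    exact ⟨_, (f.map_src i hi hi' x).symm⟩
  tgt_mem := by
    rintro i hi hi' _ ⟨x, rfl⟩
    exact ⟨_, (f.map_tgt i hi hi' x).symm⟩

/-- The union of a family of globular subsets. -/
def union {J : Type*} (A : J → Sub Y) : Sub Y where
  carrier i hi := ⋃ j, (A j).carrier i hi
  src_mem i hi hi' x hx := by
    obtain ⟨j, hj⟩ := Set.mem_iUnion.1 hx
    exact Set.mem_iUnion.2 ⟨j, (A j).src_mem i hi hi' x hj⟩
  tgt_mem i hi hi' x hx := by
    obtain ⟨j, hj⟩ := Set.mem_iUnion.1 hx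
    exact Set.mem_iUnion.2 ⟨j, (A j).tgt_mem i hi hi' x hj⟩

theorem le_union {J : Type*} (A : J → Sub Y) (j : J) : A j ≤ union A := fun _ _ _ hx =>
  Set.mem_iUnion.2 ⟨j, hx⟩

section Chain

variable {J : Type u} [LinearOrder J] (A : J → Sub Y) (hA : ∀ j j' : J, j ≤ j' → A j ≤ A j')

/-- The diagram of an increasing family of globular subsets. -/
def chain : J ⥤ GlobSet.{u} N where
  obj j := (A j).toGlobSet
  map f := inclusion (hA _ _ (leOfHom f))

/-- The union as a cocone of the diagram of an increasing family. -/
def chainCocone : Cocone (chain A hA) where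
  pt := (union A).toGlobSet
  ι := { app := fun j => inclusion (le_union A j) }

/-- Any two stages of a chain are comparable, so a map defined on the union by choosing a stage for
each cell is independent of the choices. -/
theorem chainCocone_compat (s : Cocone (chain A hA)) (i : ℕ) (hi : (i : ℕ∞) ≤ N) (j j' : J)
    (x : Y.cell i hi) (hx : x ∈ (A j).carrier i hi) (hx' : x ∈ (A j').carrier i hi) :
    (s.ι.app j).map i hi ⟨x, hx⟩ = (s.ι.app j').map i hi ⟨x, hx'⟩ := by
  have key : ∀ (p q : J) (_ : p ≤ q) (hp : x ∈ (A p).carrier i hi) (hq : x ∈ (A q).carrier i hi),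
      (s.ι.app p).map i hi ⟨x, hp⟩ = (s.ι.app q).map i hi ⟨x, hq⟩ := fun p q hpq hp hq =>
    (congr_map (s.w (homOfLE hpq)) i hi ⟨x, hp⟩).symm
  rcases le_total j j' with h | h
  · exact key _ _ h _ _
  · exact (key _ _ h _ _).symm

/-- The union of an increasing family of globular subsets is its colimit. -/
noncomputable def chainCoconeIsColimit : IsColimit (chainCocone A hA) where
  desc s :=
    { map := fun i hi x => (s.ι.app (Set.mem_iUnion.1 x.2).choose).map i hi
        ⟨x.1, (Set.mem_iUnion.1 x.2).choose_spec⟩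
      map_src := fun i hi hi' x => by
        -- The stages chosen for a cell and for its source may differ; `chainCocone_compat`
        -- reconciles them.
        refine ((s.ι.app _).map_src i hi hi' _).trans ?_
        exact chainCocone_compat A hA s i hi _ _ _ _ _
      map_tgt := fun i hi hi' x => by
        refine ((s.ι.app _).map_tgt i hi hi' _).trans ?_
        exact chainCocone_compat A hA s i hi _ _ _ _ _ }
  fac s j := hom_ext fun i hi x => chainCocone_compat A hA s i hi _ _ _ _ _
  uniq s f hf := hom_ext fun i hi x =>
    congr_map (hf (Set.mem_iUnion.1 x.2).choose) i hi ⟨x.1, (Set.mem_iUnion.1 x.2).choose_spec⟩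

end Chain

end Sub

/-- A morphism whose image is contained in that of a cellwise injective morphism factors
through it. -/
theorem CellInjective.exists_lift {X Y B : GlobSet.{u} N} {g : B ⟶ Y} (hg : CellInjective g)
    (f : X ⟶ Y) (h : Sub.range f ≤ Sub.range g) : ∃ f' : X ⟶ B, f' ≫ g = f := by
  -- Preimages under `g` are unique, so this cellwise choice automatically respects sources and
  -- targets.
  choose φ hφ using fun (i : ℕ) (hi : (i : ℕ∞) ≤ N) (x : X.cell i hi) => h i hi ⟨x, rfl⟩
  refine ⟨⟨φ, fun i hi hi' x => hg i hi ?_, fun i hi hi' x => hg i hi ?_⟩,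
    hom_ext fun i hi x => hφ i hi x⟩
  · rw [← g.map_src i hi hi', hφ, hφ, f.map_src i hi hi']
  · rw [← g.map_tgt i hi hi', hφ, hφ, f.map_tgt i hi hi']

/-- The cells of a colimit of globular sets come from the diagram. -/
theorem exists_cell_of_isColimit {J : Type*} [Category* J] {F : J ⥤ GlobSet.{u} N} {c : Cocone F}
    (hc : IsColimit c) (i : ℕ) (hi : (i : ℕ∞) ≤ N) (x : c.pt.cell i hi) :
    ∃ (j : J) (y : (F.obj j).cell i hi), (c.ι.app j).map i hi y = x := by
  -- The cocone corestricts to the union `B` of the images of its legs. The induced map into `B` is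
  -- a section of the inclusion of `B`, so `B` contains every cell.
  let B : Sub c.pt := Sub.union fun j => Sub.range (c.ι.app j)
  let s : Cocone F :=
    { pt := B.toGlobSet
      ι :=
        { app := fun j => B.lift (c.ι.app j) fun i hi x => Set.mem_iUnion.2 ⟨j, x, rfl⟩
          naturality := fun j j' f => hom_ext fun i hi x =>
            Subtype.ext (congr_map (c.w f) i hi x) } }
  have h : hc.desc s ≫ B.incl = 𝟙 _ := hc.hom_ext fun j => by
    rw [hc.fac_assoc, Category.comp_id]
    rfl
  have hx := ((hc.desc s).map i hi x).2
  rw [show ((hc.desc s).map i hi x).1 = x from congr_map h i hi x] at hx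
  exact Set.mem_iUnion.1 hx

/-! ### Bounded globular sets -/

/-- A globular set is bounded by a type if each of its sets of cells embeds into that type. -/
def Bounded (Z : Type u) (X : GlobSet.{u} N) : Prop :=
  ∀ (i : ℕ) (hi : (i : ℕ∞) ≤ N), ∃ f : X.cell i hi → Z, Function.Injective f

variable (N) in
/-- A globular set whose cells are elements of a given type. -/
structure On (Z : Type u) : Type u where
  cell (i : ℕ) (hi : (i : ℕ∞) ≤ N) : Set Z
  src (i : ℕ) (hi : (i : ℕ∞) ≤ N) (hi' : ((i + 1 : ℕ) : ℕ∞) ≤ N) : cell (i + 1) hi' → cell i hi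
  tgt (i : ℕ) (hi : (i : ℕ∞) ≤ N) (hi' : ((i + 1 : ℕ) : ℕ∞) ≤ N) : cell (i + 1) hi' → cell i hi
  src_src (i : ℕ) (hi : (i : ℕ∞) ≤ N) (hi' : ((i + 1 : ℕ) : ℕ∞) ≤ N)
    (hi'' : ((i + 1 + 1 : ℕ) : ℕ∞) ≤ N) (x : cell (i + 1 + 1) hi'') :
    src i hi hi' (src (i + 1) hi' hi'' x) = src i hi hi' (tgt (i + 1) hi' hi'' x)
  tgt_src (i : ℕ) (hi : (i : ℕ∞) ≤ N) (hi' : ((i + 1 : ℕ) : ℕ∞) ≤ N)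
    (hi'' : ((i + 1 + 1 : ℕ) : ℕ∞) ≤ N) (x : cell (i + 1 + 1) hi'') :
    tgt i hi hi' (src (i + 1) hi' hi'' x) = tgt i hi hi' (tgt (i + 1) hi' hi'' x)

/-- The globular set underlying one whose cells are elements of a given type. -/
def On.toGlobSet {Z : Type u} (P : On.{u} N Z) : GlobSet.{u} N where
  cell i hi := P.cell i hi
  src := P.src
  tgt := P.tgt
  src_src := P.src_src
  tgt_src := P.tgt_src

/-- Sources and targets are transported along the embeddings into `Z`. Since `On N Z` lives in `Type
u`, bounded globular sets form a small family up to isomorphism. -/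
theorem Bounded.exists_iso {Z : Type u} {X : GlobSet.{u} N} (h : Bounded Z X) :
    ∃ P : On.{u} N Z, Nonempty (X ≅ P.toGlobSet) := by
  choose f hf using h
  let e := fun (i : ℕ) (hi : (i : ℕ∞) ≤ N) => Equiv.ofInjective (f i hi) (hf i hi)
  let P : On.{u} N Z :=
    { cell := fun i hi => Set.range (f i hi)
      src := fun i hi hi' x => e i hi (X.src i hi hi' ((e _ hi').symm x))
      tgt := fun i hi hi' x => e i hi (X.tgt i hi hi' ((e _ hi').symm x))
      src_src := fun i hi hi' hi'' x => by simp [X.src_src]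
      tgt_src := fun i hi hi' hi'' x => by simp [X.tgt_src] }
  refine ⟨P, ⟨⟨⟨fun i hi x => e i hi x, fun i hi hi' x => ?_, fun i hi hi' x => ?_⟩,
    ⟨fun i hi x => (e i hi).symm x, fun i hi hi' x => ?_, fun i hi hi' x => ?_⟩,
    hom_ext fun i hi x => (e i hi).symm_apply_apply x,
    hom_ext fun i hi x => (e i hi).apply_symm_apply x⟩⟩⟩
  · exact congrArg (fun y => e i hi (X.src i hi hi' y)) ((e _ hi').symm_apply_apply x)
  · exact congrArg (fun y => e i hi (X.tgt i hi hi' y)) ((e _ hi').symm_apply_apply x)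
  · exact ((e i hi).symm_apply_apply _).symm
  · exact ((e i hi).symm_apply_apply _).symm

theorem Bounded.range {Z : Type u} {X Y : GlobSet.{u} N} (hX : Bounded Z X) (f : X ⟶ Y) :
    Bounded Z (Sub.range f).toGlobSet := fun i hi =>
  let ⟨g, hg⟩ := hX i hi
  ⟨fun y => g y.2.choose, fun y y' h => Subtype.ext <| by
    rw [← y.2.choose_spec, ← y'.2.choose_spec, hg h]⟩

theorem Bounded.union {J : Type u} {Z : J → Type u} {Y : GlobSet.{u} N} {A : J → Sub Y}
    (hA : ∀ j, Bounded (Z j) (A j).toGlobSet) :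
    Bounded (Σ j, Z j) (Sub.union A).toGlobSet := fun i hi => by
  choose g hg using fun j => hA j i hi
  choose j hj using fun y : (Sub.union A).toGlobSet.cell i hi => Set.mem_iUnion.1 y.2
  refine ⟨fun y => ⟨j y, g (j y) ⟨y.1, hj y⟩⟩, fun y y' h => Subtype.ext ?_⟩
  -- Stated for variable indices: an equality of the chosen `j y` and `j y'` could not be eliminated
  -- by substitution.
  have key : ∀ (p q : J) (hp : y.1 ∈ (A p).carrier i hi) (hq : y'.1 ∈ (A q).carrier i hi),
      (⟨p, g p ⟨y.1, hp⟩⟩ : Σ j, Z j) = ⟨q, g q ⟨y'.1, hq⟩⟩ → y.1 = y'.1 := by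
    intro p q hp hq h
    obtain ⟨rfl, h⟩ := Sigma.mk.inj h
    exact congrArg (fun z : (A p).carrier i hi => z.1) (hg p (eq_of_heq h))
  exact key _ _ _ _ h

/-- The type of all cells of a globular set. -/
def cells (X : GlobSet.{u} N) : Type u := Σ (i : ℕ) (hi : PLift ((i : ℕ∞) ≤ N)), X.cell i hi.down

theorem bounded_cells (X : GlobSet.{u} N) : Bounded X.cells X := fun i hi =>
  ⟨fun x => ⟨i, ⟨hi⟩, x⟩, fun _ _ h =>
    eq_of_heq (Sigma.mk.inj (eq_of_heq (Sigma.mk.inj h).2)).2⟩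

/-- A type bounding the values of a functor at the globular sets bounded by `Z`. -/
def boundMap (S : GlobSet.{u} N ⥤ GlobSet.{u} N) (Z : Type u) : Type u :=
  Σ P : On.{u} N Z, (S.obj P.toGlobSet).cells

/-- Functors preserve isomorphisms, so the value at `X` is that at some `P : On N Z`; the sum over
all such `P` gives a bound depending on `Z` alone. -/
theorem Bounded.map (S : GlobSet.{u} N ⥤ GlobSet.{u} N) {Z : Type u} {X : GlobSet.{u} N}
    (hX : Bounded Z X) : Bounded (boundMap S Z) (S.obj X) := fun i hi => by
  obtain ⟨P, ⟨e⟩⟩ := hX.exists_iso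
  obtain ⟨g, hg⟩ := bounded_cells (S.obj P.toGlobSet) i hi
  refine ⟨fun x => ⟨P, g ((S.map e.hom).map i hi x)⟩, fun x y h => ?_⟩
  have h := hg (eq_of_heq (Sigma.mk.inj h).2)
  have hid := congr_map (S.mapIso e).hom_inv_id i hi
  exact (hid x).symm.trans ((congrArg ((S.map e.inv).map i hi) h).trans (hid y))

/-- Every cell in the value of the functor at the colimit of a nonempty chain comes from its value
at some stage of the chain. -/
def CoversChainColimits {M N : ℕ∞} (S : GlobSet.{u} M ⥤ GlobSet.{u} N) : Prop :=
  ∀ (J : Type u) [LinearOrder J] [Nonempty J] (D : J ⥤ GlobSet.{u} M) (c : Cocone D)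
    (_ : IsColimit c) (i : ℕ) (hi : (i : ℕ∞) ≤ N) (x : (S.obj c.pt).cell i hi),
    ∃ (j : J) (y : (S.obj (D.obj j)).cell i hi), (S.map (c.ι.app j)).map i hi y = x

/-! ### Generated subalgebras -/

section Generated

variable {S : Monad (GlobSet.{u} N)} (D : S.Algebra)

/-- The image of `S A` in an algebra, for a globular subset `A`. -/
def algStep (A : Sub D.A) : Sub D.A := Sub.range (S.map A.incl ≫ D.a)

/-- The unit law of the algebra recovers each cell of `A` from its image under `η`. -/
theorem le_algStep (A : Sub D.A) : A ≤ algStep D A := by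
  intro i hi x hx
  refine ⟨(S.η.app A.toGlobSet).map i hi ⟨x, hx⟩, ?_⟩
  have h : S.η.app A.toGlobSet ≫ S.map A.incl ≫ D.a = A.incl := by
    have h := S.η.naturality A.incl
    dsimp at h
    rw [← reassoc_of% h, D.unit]
    rfl
  exact congr_map h i hi ⟨x, hx⟩

/-- The stages of the construction of the subalgebra generated by a globular subset. -/
def algStage (A : Sub D.A) (j : ULift.{u} ℕ) : Sub D.A := (algStep D)^[j.down] A

theorem algStage_succ (A : Sub D.A) (j : ℕ) :
    algStage D A ⟨j + 1⟩ = algStep D (algStage D A ⟨j⟩) :=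
  Function.iterate_succ_apply' _ _ _

theorem algStage_mono (A : Sub D.A) (j j' : ULift.{u} ℕ) (h : j ≤ j') :
    algStage D A j ≤ algStage D A j' := by
  obtain ⟨j⟩ := j
  obtain ⟨j'⟩ := j'
  obtain ⟨p, rfl⟩ := Nat.exists_eq_add_of_le (show j ≤ j' from h)
  clear h
  induction p with
  | zero => exact fun _ _ => le_rfl
  | succ p ih =>
    intro i hi x hx
    rw [← Nat.add_assoc, algStage_succ]
    exact le_algStep D _ i hi (ih i hi hx)

/-- The underlying globular subset of the subalgebra generated by a globular subset. -/
def algClosure (A : Sub D.A) : Sub D.A := Sub.union (algStage D A)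

theorem algStage_le_algClosure (A : Sub D.A) (j : ULift.{u} ℕ) :
    algStage D A j ≤ algClosure D A := Sub.le_union (algStage D A) j

theorem le_algClosure (A : Sub D.A) : A ≤ algClosure D A := algStage_le_algClosure D A ⟨0⟩

/-- The closure is the colimit of the stages. A cell of `S` applied to it thus comes from some stage
`j`, and the structure map sends it into stage `j + 1`. -/
theorem algStep_algClosure_le (hS : CoversChainColimits S.toFunctor) (A : Sub D.A) :
    algStep D (algClosure D A) ≤ algClosure D A := by
  rintro i hi _ ⟨x, rfl⟩
  obtain ⟨j, y, rfl⟩ := hS _ _ _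
    (Sub.chainCoconeIsColimit (algStage D A) (algStage_mono D A)) i hi x
  refine Set.mem_iUnion.2 ⟨⟨j.down + 1⟩, ?_⟩
  rw [algStage_succ]
  have h : S.map (algStage D A j).incl ≫ D.a =
      S.map (Sub.inclusion (algStage_le_algClosure D A j)) ≫
        S.map (algClosure D A).incl ≫ D.a := by
    rw [← S.map_comp_assoc]
    rfl
  exact ⟨y, congr_map h i hi y⟩

/-- The algebra structure transported along a cellwise injective map `g : B ⟶ D` from a structure
map on `B` making `g` compatible with the structure maps. -/
def algOfInjective {B : GlobSet.{u} N} (b : S.obj B ⟶ B) (g : B ⟶ D.A) (hg : CellInjective g)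
    (h : S.map g ≫ D.a = b ≫ g) : S.Algebra where
  A := B
  a := b
  unit := by
    have := hg.mono
    have hη := S.η.naturality g
    dsimp at hη
    rw [← cancel_mono g, Category.assoc, ← h, ← reassoc_of% hη, D.unit]
    simp
  assoc := by
    have := hg.mono
    have hμ := S.μ.naturality g
    dsimp at hμ
    rw [← cancel_mono g, Category.assoc, ← h, ← reassoc_of% hμ, D.assoc, Category.assoc, ← h,
      ← S.map_comp_assoc, ← S.map_comp_assoc, h]

/-- A type bounding the subalgebras generated by the globular subsets bounded by `Z`. -/
def algBound (S : GlobSet.{u} N ⥤ GlobSet.{u} N) (Z : Type u) : Type u :=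
  Σ j : ULift.{u} ℕ, (boundMap S)^[j.down] Z

theorem bounded_algClosure {Z : Type u} {A : Sub D.A} (hA : Bounded Z A.toGlobSet) :
    Bounded (algBound S.toFunctor Z) (algClosure D A).toGlobSet := by
  refine Bounded.union fun ⟨j⟩ => ?_
  induction j with
  | zero => exact hA
  | succ j ih =>
    rw [algStage_succ, Function.iterate_succ_apply']
    exact (ih.map S.toFunctor).range _

end Generated

/-- For a monad `S` covering the colimits of chains, there is a small family of algebras such that
every globular subset bounded by `Z` of an algebra is contained in a subalgebra from the family. -/
theorem exists_small_subalgebras {S : Monad (GlobSet.{u} N)}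
    (hS : CoversChainColimits S.toFunctor) (Z : Type u) :
    ∃ (ι : Type u) (B : ι → S.Algebra), ∀ (D : S.Algebra) (A : Sub D.A),
      Bounded Z A.toGlobSet → ∃ (i : ι) (g : B i ⟶ D), CellInjective g.f ∧ A ≤ Sub.range g.f := by
  -- All algebra structures on all globular sets with cells in the bounding type.
  refine ⟨Σ P : On.{u} N (algBound S.toFunctor Z), {a : S.obj P.toGlobSet ⟶ P.toGlobSet //
      S.η.app P.toGlobSet ≫ a = 𝟙 _ ∧ S.μ.app P.toGlobSet ≫ a = S.map a ≫ a},
    fun i => ⟨i.1.toGlobSet, i.2.1, i.2.2.1, i.2.2.2⟩, fun D A hA => ?_⟩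
  obtain ⟨P, ⟨e⟩⟩ := (bounded_algClosure D hA).exists_iso
  let g : P.toGlobSet ⟶ D.A := e.inv ≫ (algClosure D A).incl
  have hg : CellInjective g := fun i hi x y h => by
    have h' : e.inv.map i hi x = e.inv.map i hi y := Sub.incl_injective _ i hi h
    rw [← id_map _ i hi x, ← id_map _ i hi y, ← e.inv_hom_id, comp_map, comp_map, h']
  let a' := (algClosure D A).lift (S.map (algClosure D A).incl ≫ D.a) fun i hi x =>
    algStep_algClosure_le D hS A i hi ⟨x, rfl⟩
  let b : S.obj P.toGlobSet ⟶ P.toGlobSet := S.map e.inv ≫ a' ≫ e.hom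
  have h : S.map g ≫ D.a = b ≫ g := by
    simp only [b, g, S.map_comp, Category.assoc, e.hom_inv_id_assoc]
    rfl
  refine ⟨⟨P, b, (algOfInjective D b g hg h).unit, (algOfInjective D b g hg h).assoc⟩, ⟨g, h⟩, hg,
    fun i hi x hx => ⟨e.hom.map i hi ⟨x, le_algClosure D A i hi hx⟩, ?_⟩⟩
  exact congrArg Subtype.val (congr_map e.hom_inv_id i hi ⟨x, le_algClosure D A i hi hx⟩)

/-- A morphism to the codomain of a cellwise injective morphism of algebras factors through the
latter if it does so on cells. -/
theorem exists_algebra_lift {S : Monad (GlobSet.{u} N)} {K B D : S.Algebra} (g : B ⟶ D)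
    (hg : CellInjective g.f) (f : K ⟶ D) (h : Sub.range f.f ≤ Sub.range g.f) :
    ∃ f' : K ⟶ B, f' ≫ g = f := by
  obtain ⟨φ, hφ⟩ := hg.exists_lift f.f h
  have := hg.mono
  refine ⟨⟨φ, ?_⟩, Monad.Algebra.Hom.ext hφ⟩
  rw [← cancel_mono g.f, Category.assoc, Category.assoc, ← g.h, ← S.map_comp_assoc, hφ, f.h]

/-- Colimits of shape `J` amount to a left adjoint of the diagonal functor. Algebras inherit limits
from globular sets, so only a solution set is needed for each diagram. -/
theorem hasColimits_algebra {S : Monad (GlobSet.{u} N)} (hS : CoversChainColimits S.toFunctor) :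
    HasColimits S.Algebra where
  has_colimits_of_shape J _ := by
    have : HasLimits S.Algebra :=
      ⟨fun _ _ => ⟨fun F => Monad.hasLimit_of_comp_forget_hasLimit F⟩⟩
    rw [hasColimitsOfShape_iff_isRightAdjoint_const]
    refine isRightAdjoint_of_preservesLimits_of_solutionSetCondition _ fun K => ?_
    -- This sum bounds the union of the images of the legs of every cocone under `K`, whatever its
    -- apex.
    obtain ⟨ι, B, hB⟩ := exists_small_subalgebras hS (Σ j, (K.obj j).A.cells)
    refine ⟨Σ i : ι, K ⟶ (Functor.const J).obj (B i), fun i => B i.1, fun i => i.2,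
      fun D c => ?_⟩
    let A : Sub D.A := Sub.union fun j => Sub.range (c.app j).f
    have hA := Bounded.union (Z := fun j => (K.obj j).A.cells) (Y := D.A)
      (A := fun j => Sub.range (c.app j).f) fun j =>
      (bounded_cells (K.obj j).A).range (c.app j).f
    obtain ⟨i, g, hg, hAg⟩ := hB D A hA
    choose f hf using fun j => exists_algebra_lift g hg (c.app j) fun k hk x hx =>
      hAg k hk (Set.mem_iUnion.2 ⟨j, hx⟩)
    have : Mono g := ⟨fun a b h => Monad.Algebra.Hom.ext (by
      have := hg.mono
      exact (cancel_mono g.f).1 (congrArg Monad.Algebra.Hom.f h))⟩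
    refine ⟨⟨i, ⟨f, fun j j' k => ?_⟩⟩, g, ?_⟩
    -- The lifted legs form a cocone because they do after composition with the monomorphism `g`.
    · rw [← cancel_mono g, Category.assoc, hf]
      simp [hf]
    · ext j : 2
      exact hf j

end GlobSet

/-! ### Colimits of globular algebras and the left adjoint of truncation -/

section LevelAlgebras

variable {n : ℕ∞} (T : Monad (GlobSet.{u} n))

theorem coversChainColimits_of_isFinitaryMonad [IsFinitaryMonad T] :
    GlobSet.CoversChainColimits T.toFunctor := fun J _ _ _ _ hc i hi x => by
  have := IsFinitaryMonad.preservesDirectedColimits (T := T) J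
  exact GlobSet.exists_cell_of_isColimit (isColimitOfPreserves T.toFunctor hc) i hi x

/-- Inclusion preserves colimits as a left adjoint, and the final truncation leaves the cells of
dimension at most `k` unchanged. -/
theorem coversChainColimits_truncMonad [IsFinitaryMonad T] (k : ℕ) (hk : (k : ℕ∞) < n) :
    GlobSet.CoversChainColimits (GlobSet.truncMonad T k hk).toFunctor := fun J _ _ _ _ hc i hi x =>
  have : PreservesColimitsOfSize.{u, u} (GlobSet.inc.{u} hk.le) :=
    (GlobSet.incTruncAdj hk.le).leftAdjoint_preservesColimits
  coversChainColimits_of_isFinitaryMonad T J _ _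
    (isColimitOfPreserves (GlobSet.inc hk.le) hc) i (hi.trans hk.le) x

theorem coversChainColimits_levelMonad [IsFinitaryMonad T] :
    ∀ l : Level n, GlobSet.CoversChainColimits (levelMonad T l).toFunctor
  | .top => coversChainColimits_of_isFinitaryMonad T
  | .below k hk => coversChainColimits_truncMonad T k hk

theorem hasColimits_globAlg [IsFinitaryMonad T] (l : Level n) : HasColimits (GlobAlg T l) :=
  GlobSet.hasColimits_algebra (coversChainColimits_levelMonad T l)

/-- Adjoint lifting along the monadic functor `globForget T m`. The square of truncation and
forgetful functors commutes definitionally, so its diagonal is a composite of right adjoints. -/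
theorem isRightAdjoint_algTrunc [IsFinitaryMonad T] {m l : Level n} (h : m.dim < l.dim) :
    (algTrunc T h).IsRightAdjoint := by
  have := hasColimits_globAlg T l
  have : (GlobSet.trunc.{u} h.le).IsRightAdjoint := (GlobSet.incTruncAdj h.le).isRightAdjoint
  have : (algTrunc T h ⋙ globForget T m).IsRightAdjoint :=
    inferInstanceAs (globForget T l ⋙ GlobSet.trunc h.le).IsRightAdjoint
  exact isRightAdjoint_triangle_lift_monadic (globForget T m)

end LevelAlgebras

/-! ### Morphisms of cellular extensions as commutative squares -/

section CellularPushout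

variable {n : ℕ∞} {T : Monad (GlobSet.{u} n)} {m l : Level n} {h : m.dim < l.dim}
  {I : GlobAlg T m ⥤ GlobAlg T l}

/-- The bijection `Hom (F (inc Z), D) ≃ Hom (Z, trunc (U D))`. -/
def incFreeEquiv (h : m.dim < l.dim) (Z : GlobSet.{u} m.dim) (D : GlobAlg T l) :
    ((globFree T l).obj ((GlobSet.inc h.le).obj Z) ⟶ D) ≃
      (Z ⟶ (GlobSet.trunc h.le).obj ((globForget T l).obj D)) :=
  ((globAdj T l).homEquiv _ _).trans ((GlobSet.incTruncAdj h.le).homEquiv _ _)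

theorem incFreeEquiv_naturality_left {Z Z' : GlobSet.{u} m.dim} {D : GlobAlg T l} (f : Z' ⟶ Z)
    (g : (globFree T l).obj ((GlobSet.inc h.le).obj Z) ⟶ D) :
    incFreeEquiv h Z' D ((globFree T l).map ((GlobSet.inc h.le).map f) ≫ g) =
      f ≫ incFreeEquiv h Z D g := by
  simp only [incFreeEquiv, Equiv.trans_apply, Adjunction.homEquiv_naturality_left]

theorem incFreeEquiv_counit (X : GlobSet.{u} l.dim) {D : GlobAlg T l}
    (g : (globFree T l).obj X ⟶ D) :
    incFreeEquiv h _ D ((globFree T l).map ((GlobSet.incTruncCounit h.le).app X) ≫ g) =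
      (GlobSet.trunc h.le).map ((globAdj T l).homEquiv _ _ g) := by
  rw [incFreeEquiv, Equiv.trans_apply, Adjunction.homEquiv_naturality_left]
  rfl

theorem incFreeEquiv_counit_comp {D D' : GlobAlg T l} (g : D' ⟶ D) :
    incFreeEquiv h _ D ((globFree T l).map ((GlobSet.incTruncCounit h.le).app D'.A) ≫
      (globAdj T l).counit.app D' ≫ g) = (GlobSet.trunc h.le).map g.f := by
  refine (incFreeEquiv_counit ((globForget T l).obj D') ((globAdj T l).counit.app D' ≫ g)).trans
    (congrArg (GlobSet.trunc h.le).map ?_)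
  rw [Adjunction.homEquiv_unit, Functor.map_comp,
    Adjunction.right_triangle_components_assoc]
  rfl

/-- This identifies `theta` as the canonical comparison between two left adjoints of the same
functor, by a triangle identity. -/
theorem incFreeEquiv_theta (adjI : I ⊣ algTrunc T h) (Z : GlobSet.{u} m.dim) {D : GlobAlg T l}
    (g : I.obj ((globFree T m).obj Z) ⟶ D) :
    incFreeEquiv h Z D (theta adjI Z ≫ g) =
      (globAdj T m).homEquiv _ _ (adjI.homEquiv _ _ g) := by
  rw [theta, Category.assoc, incFreeEquiv_naturality_left, Category.assoc,
    incFreeEquiv_naturality_left, Category.assoc, Adjunction.homEquiv_unit,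
    Adjunction.homEquiv_unit, Functor.map_comp]
  exact congrArg (fun f => (globAdj T m).unit.app Z ≫
    (globForget T m).map (adjI.unit.app ((globFree T m).obj Z)) ≫ f) (incFreeEquiv_counit_comp g)

theorem incFreeEquiv_eLeftTheta (adjI : I ⊣ algTrunc T h) (E : CellExt T h) {D : GlobAlg T l}
    (g : I.obj E.left ⟶ D) :
    incFreeEquiv h _ D (eLeftTheta adjI E ≫ g) =
      eqToHom E.eq.symm ≫ (globForget T m).map (adjI.homEquiv _ _ g) := by
  rw [eLeftTheta, Category.assoc, incFreeEquiv_naturality_left, Category.assoc,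
    incFreeEquiv_theta, Adjunction.homEquiv_naturality_left,
    Adjunction.homEquiv_naturality_right, ← Adjunction.homEquiv_symm_id, Equiv.apply_symm_apply,
    Category.id_comp]
  rfl

/-- The trivial `e'` is there for the object equality of a cellular extension `V D`, which holds by
`rfl`. -/
theorem eq_eqToHom_comp_iff {C : Type*} [Category* C] {X Y Z : C} (e : X = Y) (e' : Z = Z)
    (p : X ⟶ Z) (q : Y ⟶ Z) :
    q = eqToHom e.symm ≫ p ↔ p ≫ eqToHom e' = eqToHom e ≫ q := by
  subst e
  simp [eq_comm]

/-- The first component `C ⟶ trunc D` of a morphism `(C, X) ⟶ V D`. -/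
def cellExtHomLeft {E : CellExt T h} {D : GlobAlg T l} (φ : E ⟶ (algToCellExt T h).obj D) :
    E.left ⟶ (algTrunc T h).obj D := φ.left

/-- The second component `X ⟶ U D` of a morphism `(C, X) ⟶ V D`. -/
def cellExtHomRight {E : CellExt T h} {D : GlobAlg T l} (φ : E ⟶ (algToCellExt T h).obj D) :
    E.right ⟶ (globForget T l).obj D := φ.right

theorem cellExtHom_ext {E : CellExt T h} {D : GlobAlg T l} {φ ψ : E ⟶ (algToCellExt T h).obj D}
    (hl : cellExtHomLeft φ = cellExtHomLeft ψ) (hr : cellExtHomRight φ = cellExtHomRight ψ) :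
    φ = ψ :=
  StrictPullback.Hom.ext hl hr

/-- The condition for morphisms `C ⟶ trunc D` and `X ⟶ U D` to be the components of a morphism
`(C, X) ⟶ V D`. -/
def CellExtCompat {E : CellExt T h} {D : GlobAlg T l} (p : E.left ⟶ (algTrunc T h).obj D)
    (q : E.right ⟶ (globForget T l).obj D) : Prop :=
  (globForget T m).map p ≫ eqToHom ((algToCellExt T h).obj D).eq =
    eqToHom E.eq ≫ (GlobSet.trunc h.le).map q

/-- Both composites are compared through `incFreeEquiv`, which turns them into the truncation of one
transpose and the underlying map of the other. -/
theorem eRight_comp_eq_eLeftTheta_comp_iff (adjI : I ⊣ algTrunc T h) (E : CellExt T h)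
    {D : GlobAlg T l} (b : (globFree T l).obj E.right ⟶ D) (a : I.obj E.left ⟶ D) :
    eRight E ≫ b = eLeftTheta adjI E ≫ a ↔
      CellExtCompat (adjI.homEquiv _ _ a) ((globAdj T l).homEquiv _ _ b) := by
  rw [← (incFreeEquiv h _ D).apply_eq_iff_eq, incFreeEquiv_eLeftTheta, eRight,
    incFreeEquiv_counit]
  exact eq_eqToHom_comp_iff E.eq ((algToCellExt T h).obj D).eq _ _

/-- The morphism `(C, X) ⟶ V D` with given components. -/
def cellExtHomMk {E : CellExt T h} {D : GlobAlg T l} (p : E.left ⟶ (algTrunc T h).obj D)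
    (q : E.right ⟶ (globForget T l).obj D) (w : CellExtCompat p q) :
    E ⟶ (algToCellExt T h).obj D := ⟨p, q, w⟩

theorem cellExtCompat_components {E : CellExt T h} {D : GlobAlg T l}
    (φ : E ⟶ (algToCellExt T h).obj D) :
    CellExtCompat (cellExtHomLeft φ) (cellExtHomRight φ) := φ.w

/-- The morphism `(C, X) ⟶ V D` corresponding to compatible morphisms `F X ⟶ D` and `I C ⟶ D`. -/
def cellExtTranspose (adjI : I ⊣ algTrunc T h) (E : CellExt T h) {D : GlobAlg T l}
    (b : (globFree T l).obj E.right ⟶ D) (a : I.obj E.left ⟶ D)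
    (w : eRight E ≫ b = eLeftTheta adjI E ≫ a) : E ⟶ (algToCellExt T h).obj D :=
  cellExtHomMk _ _ ((eRight_comp_eq_eLeftTheta_comp_iff adjI E b a).1 w)

theorem cellExtTranspose_comp (adjI : I ⊣ algTrunc T h) (E : CellExt T h) {D D' : GlobAlg T l}
    (b : (globFree T l).obj E.right ⟶ D) (a : I.obj E.left ⟶ D)
    (w : eRight E ≫ b = eLeftTheta adjI E ≫ a) (f : D ⟶ D') :
    cellExtTranspose adjI E b a w ≫ (algToCellExt T h).map f =
      cellExtTranspose adjI E (b ≫ f) (a ≫ f) (by rw [reassoc_of% w]) :=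
  cellExtHom_ext (adjI.homEquiv_naturality_right a f).symm
    ((globAdj T l).homEquiv_naturality_right b f).symm

theorem cellExtTranspose_injective (adjI : I ⊣ algTrunc T h) (E : CellExt T h) {D : GlobAlg T l}
    {b b' : (globFree T l).obj E.right ⟶ D} {a a' : I.obj E.left ⟶ D}
    {w : eRight E ≫ b = eLeftTheta adjI E ≫ a} {w' : eRight E ≫ b' = eLeftTheta adjI E ≫ a'}
    (H : cellExtTranspose adjI E b a w = cellExtTranspose adjI E b' a' w') : b = b' ∧ a = a' :=
  ⟨((globAdj T l).homEquiv _ _).injective (congrArg cellExtHomRight H),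
    (adjI.homEquiv _ _).injective (congrArg cellExtHomLeft H)⟩

theorem exists_cellExtTranspose_eq (adjI : I ⊣ algTrunc T h) {E : CellExt T h} {D : GlobAlg T l}
    (φ : E ⟶ (algToCellExt T h).obj D) :
    ∃ w : eRight E ≫ ((globAdj T l).homEquiv _ _).symm (cellExtHomRight φ) =
        eLeftTheta adjI E ≫ (adjI.homEquiv _ _).symm (cellExtHomLeft φ),
      cellExtTranspose adjI E _ _ w = φ := by
  refine ⟨?_, cellExtHom_ext (Equiv.apply_symm_apply _ _) (Equiv.apply_symm_apply _ _)⟩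
  rw [eRight_comp_eq_eLeftTheta_comp_iff, Equiv.apply_symm_apply, Equiv.apply_symm_apply]
  exact cellExtCompat_components φ

/-- Maps out of the pushout are commutative squares, which transpose to morphisms of cellular
extensions. -/
theorem bijective_cellExtTranspose_comp (adjI : I ⊣ algTrunc T h) (E : CellExt T h)
    {P : GlobAlg T l} {b : (globFree T l).obj E.right ⟶ P} {a : I.obj E.left ⟶ P}
    (hP : IsPushout (eRight E) (eLeftTheta adjI E) b a) (D : GlobAlg T l) :
    Function.Bijective fun f : P ⟶ D =>
      cellExtTranspose adjI E b a hP.w ≫ (algToCellExt T h).map f := by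
  refine ⟨fun f g hfg => ?_, fun φ => ?_⟩
  · simp only [cellExtTranspose_comp] at hfg
    have := cellExtTranspose_injective adjI E hfg
    exact hP.hom_ext this.1 this.2
  · obtain ⟨w, hw⟩ := exists_cellExtTranspose_eq adjI φ
    refine ⟨hP.desc _ _ w, ?_⟩
    simp only [cellExtTranspose_comp, hP.inl_desc, hP.inr_desc, hw]

theorem isRightAdjoint_algToCellExt [HasPushouts (GlobAlg T l)] (adjI : I ⊣ algTrunc T h) :
    (algToCellExt T h).IsRightAdjoint :=
  (Adjunction.adjunctionOfEquivLeft
    (fun E D => Equiv.ofBijective _ (bijective_cellExtTranspose_comp adjI E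
      (IsPushout.of_hasPushout (eRight E) (eLeftTheta adjI E)) D))
    fun E D D' g f => by simp).isRightAdjoint

theorem isPushout_pRight_pLeft (adjI : I ⊣ algTrunc T h) {L : CellExt T h ⥤ GlobAlg T l}
    (adjL : L ⊣ algToCellExt T h) (E : CellExt T h) :
    IsPushout (eRight E) (eLeftTheta adjI E) (pRight adjL E) (pLeft adjI adjL E) := by
  obtain ⟨w, hw⟩ : ∃ w : eRight E ≫ pRight adjL E = eLeftTheta adjI E ≫ pLeft adjI adjL E,
      cellExtTranspose adjI E _ _ w = adjL.unit.app E :=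
    exists_cellExtTranspose_eq adjI (adjL.unit.app E)
  -- The unit is the transpose of the pair `pRight`, `pLeft`; by naturality, the adjunction
  -- bijection is then composition with that pair followed by transposition.
  have key (D : GlobAlg T l) (f : L.obj E ⟶ D) : adjL.homEquiv E D f =
      cellExtTranspose adjI E (pRight adjL E ≫ f) (pLeft adjI adjL E ≫ f)
        (by rw [reassoc_of% w]) := by
    rw [Adjunction.homEquiv_unit, ← hw, cellExtTranspose_comp]
  have desc (s : PushoutCocone (eRight E) (eLeftTheta adjI E)) := cellExtTranspose_injective adjI E
    ((key s.pt ((adjL.homEquiv E s.pt).symm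
      (cellExtTranspose adjI E s.inl s.inr s.condition))).symm.trans (Equiv.apply_symm_apply _ _))
  refine ⟨⟨w⟩, ⟨PushoutCocone.IsColimit.mk w
    (fun s => (adjL.homEquiv E s.pt).symm (cellExtTranspose adjI E s.inl s.inr s.condition))
    (fun s => (desc s).1) (fun s => (desc s).2) fun s f hb ha => ?_⟩⟩
  rw [Equiv.eq_symm_apply, key]
  simp only [hb, ha]

end CellularPushout

theorem mainTheorem5 {n : ℕ∞} (T : Monad (GlobSet.{u} n)) [IsFinitaryMonad T] (k : ℕ)
    (m l : Level n) (hm : m.dim = k) (hl : l.dim = (k + 1 : ℕ)) :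
    (algToCellExt T (Level.lt_of_dim_eq hm hl)).IsRightAdjoint ∧
    (algTrunc T (Level.lt_of_dim_eq hm hl)).IsRightAdjoint ∧
    ∀ (I : GlobAlg T m ⥤ GlobAlg T l) (adjI : I ⊣ algTrunc T (Level.lt_of_dim_eq hm hl))
      (L : CellExt T (Level.lt_of_dim_eq hm hl) ⥤ GlobAlg T l)
      (adjL : L ⊣ algToCellExt T (Level.lt_of_dim_eq hm hl))
      (E : CellExt T (Level.lt_of_dim_eq hm hl)),
      IsPushout (eRight E) (eLeftTheta adjI E) (pRight adjL E) (pLeft adjI adjL E) := by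
  have := hasColimits_globAlg T l
  have htrunc := isRightAdjoint_algTrunc T (Level.lt_of_dim_eq hm hl)
  -- Any left adjoint of truncation serves to build the one of `algToCellExt`.
  exact ⟨isRightAdjoint_algToCellExt (Adjunction.ofIsRightAdjoint _), htrunc,
    fun _ adjI _ adjL E => isPushout_pRight_pLeft adjI adjL E⟩
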